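/- **Setting.** Let $B=(V,E,\preceq)$ be a properly ordered Bratteli diagram: finite levels $V_0=\{v_0\},V_1,V_2,\dots$, finite edge sets $E_n$ from $V_{n-1}$ to $V_n$ (every vertex of $V_n$, $n\ge1$, is the end of an edge of $E_n$, and every vertex of $V_n$, $n\ge 0$, is the start of an edge of $E_{n+1}$), a partial order on the edges for which two edges are comparable iff they have the same end-point, and exactly one infinite path of maximal edges and exactly one of minimal edges. Let $X$ be the space of infinite paths from $v_0$, with the topology generated by the cylinder sets, assumed to be a Cantor set, and let $T:X\to X$ be the Vershik (successor) map. Assume that the representation is *proper of rank $d$*: $V_n$ is identified with $\{1,\dots,d\}$ for all $n\ge 1$; every vertex of $V_1$ is reached by exactly one edge from $v_0$; for $n\ge2$ every vertex of $V_{n-1}$ is joined to every vertex of $V_n$; for $n\ge2$ all maximal edges of $E_n$ start in the same vertex. Assume also that it is of *Toeplitz type* with characteristic sequence $(q_n)_{n\ge1}$: every vertex of $V_n$ is the end of exactly $q_n$ edges of $E_n$. Put $p_n=q_1\cdots q_n$ and $q_{m,n}=q_{m+1}\cdots q_n$. For $x\in X$ let $\tau_n(x)\in V_n$ be the vertex of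 level $n$ through which $x$ passes. Assume that the diagram is *clean*: there are $\delta>0$ and sets $I_\mu\subseteq\{1,\dots,d\}$, one for each ergodic $T$-invariant Borel probability measure $\mu$, such that $\mu(\tau_n=t)\ge\delta$ for all $t\in I_\mu$ and $n\ge1$, $\lim_{n\to\infty}\mu(\tau_n=t)=0$ for all $t\notin I_\mu$, and $I_\mu\cap I_\nu=\emptyset$ for $\mu\ne\nu$. (These sets are uniquely determined.) For $1\le m<n$ and $x\in X$ let $\bar s_{m,n}(x)$ be the number of paths from $V_m$ to $V_n$ that end at $\tau_n(x)$ and are strictly bigger than $(x_{m+1},\dots,x_n)$ for the induced order (at the last edge where two paths differ, the bigger path has the bigger edge). For $t_1\in V_m$, $t_2\in V_n$ put $\bar S_{m,n}(t_1,t_2)=\{\bar s_{m,n}(x):\tau_m(x)=t_1,\ \tau_n(x)=t_2\}$. **Statement.** Let $\mu$ be an ergodic probability measure of $(X,T)$, let $\lambda=\exp(2i\pi a/b)$ with integers $a$ and $b\ge1$, $(a,b)=1$, and let $\mathbf b$ be the integer with $b/(b,p_n)=\mathbf b$ for all large enough $n$. For $1\le m<n$ put $$\rho_{m,n}(t_1,t_2)=\frac{1}{q_{m,n}}\Bigl|\sum_{s\in\bar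 S_{m,n}(t_1,t_2)}\lambda^{-p_ms}\Bigr| .$$ Let $J=\{1,\dots,d\}\ (=V_m)$ or $J=I_\mu$. In each of these two cases the following conditions are equivalent: 1. for all $t_2\in I_\mu$, $\displaystyle\sum_{t_1\in J}\rho_{m,n}(t_1,t_2)\longrightarrow 1$ as $m,n\to\infty$, uniformly in $m<n$; that is, for every $\varepsilon>0$ there is $N$ such that $\bigl|\sum_{t_1\in J}\rho_{m,n}(t_1,t_2)-1\bigr|<\varepsilon$ whenever $N\le m<n$; 2. for all $t_2\in I_\mu$ and $m\ge1$ there is a sequence of partitions $(\mathcal H_{m,n,t_2};\,n>m)$ of $J$ into exactly $\mathbf b$ (non-empty) atoms, such that for all $t_2\in I_\mu$ and $\varepsilon>0$ there is $N$ with $$\Bigl|\sum_{t_1\in A}\rho_{m,n}(t_1,t_2)-\frac1{\mathbf b}\Bigr|<\varepsilon\qquad\text{whenever } N\le m<n\text{ and }A\in\mathcal H_{m,n,t_2}.$$ -/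

import Mathlib

open Filter Topology MeasureTheory

universe u

/-- A Bratteli diagram. `E n` is the set of edges joining `V n` to `V (n + 1)`, that is, the set
which is usually written `E_{n+1}`. -/
structure BratteliDiagram where
  V : ℕ → Type u
  E : ℕ → Type u
  finV : ∀ n, Finite (V n)
  finE : ∀ n, Finite (E n)
  src : ∀ {n : ℕ}, E n → V n
  tgt : ∀ {n : ℕ}, E n → V (n + 1)
  /-- the single vertex of level zero -/
  root : V 0
  eq_root : ∀ v : V 0, v = root
  src_surjective : ∀ n, Function.Surjective (src : E n → V n)
  tgt_surjective : ∀ n, Function.Surjective (tgt : E n → V (n + 1))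

/-- An ordered Bratteli diagram: two edges are comparable if and only if they have the same
end-point. -/
structure OrderedBratteliDiagram extends BratteliDiagram.{u} where
  order : ∀ n, PartialOrder (E n)
  comparable_iff : ∀ (n : ℕ) (e f : E n), (e ≤ f ∨ f ≤ e) ↔ tgt e = tgt f

attribute [instance] BratteliDiagram.finV BratteliDiagram.finE OrderedBratteliDiagram.order

namespace OrderedBratteliDiagram

/-- The space of infinite paths starting in the root. -/
def PathSpace (B : OrderedBratteliDiagram.{u}) : Type u :=
  {x : (n : ℕ) → B.E n // ∀ n, B.tgt (x n) = B.src (x (n + 1))}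

/-- The `n`-th edge of an infinite path. -/
def edge {B : OrderedBratteliDiagram.{u}} (x : B.PathSpace) (n : ℕ) : B.E n := x.1 n

/-- The topology generated by the cylinder sets: the product of the discrete topologies. -/
instance (B : OrderedBratteliDiagram.{u}) : TopologicalSpace B.PathSpace :=
  TopologicalSpace.induced (fun x => x.1) (@Pi.topologicalSpace ℕ B.E (fun _ => ⊥))

instance (B : OrderedBratteliDiagram.{u}) : MeasurableSpace B.PathSpace := borel _

instance (B : OrderedBratteliDiagram.{u}) : BorelSpace B.PathSpace := ⟨rfl⟩

/-- There is exactly one infinite path made of maximal edges and exactly one infinite path made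
of minimal edges. -/
def IsProperlyOrdered (B : OrderedBratteliDiagram.{u}) : Prop :=
  (∃! x : B.PathSpace, ∀ n, IsMax (edge x n)) ∧ (∃! x : B.PathSpace, ∀ n, IsMin (edge x n))

/-- `y` is the successor of `x`: the first edge of `x` that is not maximal is replaced by its
successor, all edges before it by minimal edges, and the edges after it are kept. -/
def IsSuccessor {B : OrderedBratteliDiagram.{u}} (x y : B.PathSpace) : Prop :=
  ∃ n, (∀ i < n, IsMax (edge x i)) ∧ edge x n ⋖ edge y n ∧ (∀ i < n, IsMin (edge y i)) ∧
    ∀ i, n < i → edge y i = edge x i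

theorem exists_minimal_path (B : OrderedBratteliDiagram.{u}) (n : ℕ) :
    ∀ v : B.V (n + 1), ∃ p : (i : ℕ) → B.E i, (∀ i ≤ n, IsMin (p i)) ∧
      (∀ i < n, B.tgt (p i) = B.src (p (i + 1))) ∧ B.tgt (p n) = v := by
  classical
  have key : ∀ (n : ℕ) (v : B.V (n + 1)), ∃ e : B.E n, IsMin e ∧ B.tgt e = v := by
    intro n v
    obtain ⟨e, he⟩ := B.tgt_surjective n v
    obtain ⟨f, hfe, hf⟩ := exists_minimal_le_of_wellFoundedLT (fun _ => True) e trivial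
    exact ⟨f, fun g hg => hf.2 trivial hg, by rw [← he]; exact (B.comparable_iff n f e).1 (Or.inl hfe)⟩
  have hE : ∀ i, Nonempty (B.E i) := by
    intro i
    induction i with
    | zero => exact ⟨(B.src_surjective 0 B.root).choose⟩
    | succ k ih =>
      obtain ⟨e⟩ := ih
      exact ⟨(B.src_surjective (k + 1) (B.tgt e)).choose⟩
  induction n with
  | zero =>
    intro v
    obtain ⟨e, he, hv⟩ := key 0 v
    refine ⟨Function.update (fun i => (hE i).some) 0 e, ?_, ?_, ?_⟩
    · intro i hi
      obtain rfl : i = 0 := by omega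
      simpa using he
    · intro i hi
      omega
    · simpa using hv
  | succ n ih =>
    intro v
    obtain ⟨e, he, hv⟩ := key (n + 1) v
    obtain ⟨p, hp1, hp2, hp3⟩ := ih (B.src e)
    refine ⟨Function.update p (n + 1) e, ?_, ?_, ?_⟩
    · intro i hi
      rcases Nat.lt_or_ge i (n + 1) with h | h
      · rw [Function.update_of_ne (by omega)]
        exact hp1 i (by omega)
      · obtain rfl : i = n + 1 := by omega
        simpa using he
    · intro i hi
      rcases Nat.lt_or_ge i n with h | h
      · rw [Function.update_of_ne (by omega), Function.update_of_ne (by omega)]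
        exact hp2 i h
      · obtain rfl : i = n := by omega
        rw [Function.update_of_ne (by omega), Function.update_self]
        exact hp3
    · simpa using hv

theorem exists_isSuccessor {B : OrderedBratteliDiagram.{u}} (x : B.PathSpace)
    (hx : ∃ n, ¬ IsMax (edge x n)) : ∃ y, IsSuccessor x y := by
  classical
  have hmax : ∀ i < Nat.find hx, IsMax (edge x i) := fun i hi => by
    exact not_not.1 (Nat.find_min hx hi)
  have hn := Nat.find_spec hx
  generalize Nat.find hx = n at hmax hn
  obtain ⟨f, hf⟩ := exists_covBy_of_wellFoundedLT hn
  have hft : B.tgt (edge x n) = B.tgt f := (B.comparable_iff n _ _).1 (Or.inl hf.le)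
  cases n with
  | zero =>
    refine ⟨⟨Function.update x.1 0 f, ?_⟩, 0, hmax, ?_, ?_, ?_⟩
    · intro i
      rcases Nat.eq_zero_or_pos i with rfl | h
      · rw [Function.update_self, Function.update_of_ne (by omega), ← hft]
        exact x.2 0
      · rw [Function.update_of_ne (by omega), Function.update_of_ne (by omega)]
        exact x.2 i
    · simpa [edge] using hf
    · intro i hi
      omega
    · intro i hi
      exact Function.update_of_ne (by omega) _ _
  | succ k =>
    obtain ⟨p, hp1, hp2, hp3⟩ := B.exists_minimal_path k (B.src f)
    let y : (i : ℕ) → B.E i := fun i => if i ≤ k then p i else Function.update x.1 (k + 1) f i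
    have hlow : ∀ i ≤ k, y i = p i := fun i hi => if_pos hi
    have hmid : y (k + 1) = f := by
      simp only [y]
      rw [if_neg (by omega), Function.update_self]
    have hhigh : ∀ i, k + 1 < i → y i = x.1 i := fun i hi => by
      simp only [y]
      rw [if_neg (by omega), Function.update_of_ne (by omega)]
    refine ⟨⟨y, ?_⟩, k + 1, hmax, ?_, ?_, ?_⟩
    · intro i
      rcases Nat.lt_trichotomy i k with h | h | h
      · rw [hlow i (by omega), hlow (i + 1) (by omega)]
        exact hp2 i h
      · subst h
        rw [hlow i le_rfl, hmid]
        exact hp3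
      · rcases Nat.lt_or_ge (k + 1) i with h' | h'
        · rw [hhigh i h', hhigh (i + 1) (by omega)]
          exact x.2 i
        · obtain rfl : i = k + 1 := by omega
          rw [hmid, hhigh (k + 1 + 1) (by omega), ← hft]
          exact x.2 (k + 1)
    · change edge x (k + 1) ⋖ y (k + 1)
      rw [hmid]
      exact hf
    · intro i hi
      change IsMin (y i)
      rw [hlow i (by omega)]
      exact hp1 i (by omega)
    · intro i hi
      exact hhigh i hi

/-- The successor is unique, so the choice in `vershik` below is no choice. -/
theorem IsSuccessor.unique {B : OrderedBratteliDiagram.{u}} {x y z : B.PathSpace}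
    (hy : IsSuccessor x y) (hz : IsSuccessor x z) : y = z := by
  obtain ⟨n, h1, h2, h3, h4⟩ := hy
  obtain ⟨k, g1, g2, g3, g4⟩ := hz
  have hnk : n = k := by
    rcases Nat.lt_trichotomy n k with h | h | h
    · exact absurd (g1 n h) (fun hm => hm.not_lt h2.lt)
    · exact h
    · exact absurd (h1 k h) (fun hm => hm.not_lt g2.lt)
  subst hnk
  have hn : edge y n = edge z n := by
    have t1 := (B.comparable_iff n _ _).1 (Or.inl h2.le)
    have t2 := (B.comparable_iff n _ _).1 (Or.inl g2.le)
    rcases (B.comparable_iff n (edge y n) (edge z n)).2 (t1.symm.trans t2) with h | h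
    · exact (h.eq_or_lt).elim id (fun h' => absurd h' (g2.2 h2.lt))
    · exact ((h.eq_or_lt).elim id (fun h' => absurd h' (h2.2 g2.lt))).symm
  have hdown : ∀ j ≤ n, edge y (n - j) = edge z (n - j) := by
    intro j
    induction j with
    | zero => exact fun _ => hn
    | succ j ih =>
      intro hj
      have ih' := ih (by omega)
      obtain ⟨i, hi⟩ : ∃ i, i = n - (j + 1) := ⟨_, rfl⟩
      have hi' : n - j = i + 1 := by omega
      rw [hi'] at ih'
      rw [← hi]
      have ht : B.tgt (edge y i) = B.tgt (edge z i) := by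
        have ay : B.tgt (edge y i) = B.src (edge y (i + 1)) := y.2 i
        have az : B.tgt (edge z i) = B.src (edge z (i + 1)) := z.2 i
        rw [ay, az, ih']
      rcases (B.comparable_iff i _ _).2 ht with h | h
      · exact (g3 i (by omega)).eq_of_le h
      · exact ((h3 i (by omega)).eq_of_le h).symm
  apply Subtype.ext
  funext i
  rcases Nat.lt_or_ge n i with h | h
  · exact (h4 i h).trans (g4 i h).symm
  · have := hdown (n - i) (by omega)
    rwa [Nat.sub_sub_self h] at this

open Classical in
/-- The Vershik map of a properly ordered Bratteli diagram. -/
noncomputable def vershik (B : OrderedBratteliDiagram.{u}) (hB : B.IsProperlyOrdered)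
    (x : B.PathSpace) : B.PathSpace :=
  if h : ∃ n, ¬ IsMax (edge x n) then (exists_isSuccessor x h).choose else hB.2.choose

/-- The vertex of level `n` through which the path `x` passes, i.e. the tower of the `n`-th
Kakutani-Rohlin partition that contains `x`. -/
def tau {B : OrderedBratteliDiagram.{u}} (n : ℕ) (x : B.PathSpace) : B.V n := B.src (edge x n)

/-- The entry at `(t₁, t₂)` of the incidence matrix between the levels `n` and `n + 1`. -/
noncomputable def incidence (B : OrderedBratteliDiagram.{u}) (n : ℕ) (t₁ : B.V n)
    (t₂ : B.V (n + 1)) : ℕ :=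
  Nat.card {e : B.E n // B.src e = t₁ ∧ B.tgt e = t₂}

/-- `B` is a proper Bratteli-Vershik representation of rank `d` of a minimal Cantor system, where
`vtx n t` is the vertex `t ∈ {1, …, d}` of level `n` (the identification of `V n` with
`{1, …, d}` for `n ≥ 1`). -/
structure IsProperRepresentation (B : OrderedBratteliDiagram.{u}) (d : ℕ)
    (vtx : (n : ℕ) → Fin d → B.V n) : Prop where
  properlyOrdered : B.IsProperlyOrdered
  /-- the path space is a Cantor set: it has no isolated points -/
  perfect : PerfectSpace B.PathSpace
  /-- (H1) -/
  hat : ∀ t : B.V 1, B.incidence 0 B.root t = 1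
  /-- (H2) -/
  incidence_pos : ∀ n, 1 ≤ n → ∀ (t₁ : B.V n) (t₂ : B.V (n + 1)), 0 < B.incidence n t₁ t₂
  /-- (H3) -/
  vtx_bijective : ∀ n, 1 ≤ n → Function.Bijective (vtx n)
  /-- (H4) -/
  maximal_edges : ∀ n, 1 ≤ n → ∃ t : B.V n, ∀ e : B.E n, IsMax e → B.src e = t

/-- `B` is of Toeplitz type with characteristic sequence `(q n)_{n ≥ 1}`. -/
def IsToeplitz (B : OrderedBratteliDiagram.{u}) (q : ℕ → ℕ) : Prop :=
  ∀ (n : ℕ) (t : B.V (n + 1)), Nat.card {e : B.E n // B.tgt e = t} = q (n + 1)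

/-- `μ` is an ergodic (invariant, Borel) probability measure of the Bratteli-Vershik system. -/
def IsErgodicMeasure (B : OrderedBratteliDiagram.{u}) (hB : B.IsProperlyOrdered)
    (μ : Measure B.PathSpace) : Prop :=
  IsProbabilityMeasure μ ∧ Ergodic (B.vershik hB) μ

open Classical in
/-- The set `I_μ` of the `t ∈ {1, …, d}` for which the measure of the tower `t` of level `n`
is bounded away from zero, uniformly in `n ≥ 1`. -/
noncomputable def mainVertices {B : OrderedBratteliDiagram.{u}} {d : ℕ}
    (vtx : (n : ℕ) → Fin d → B.V n) (μ : Measure B.PathSpace) : Finset (Fin d) :=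
  Finset.univ.filter fun t => ∃ δ : ℝ, 0 < δ ∧ ∀ n, 1 ≤ n → δ ≤ μ.real {x | tau n x = vtx n t}

/-- The diagram is clean. -/
def IsClean (B : OrderedBratteliDiagram.{u}) (hB : B.IsProperlyOrdered) {d : ℕ}
    (vtx : (n : ℕ) → Fin d → B.V n) : Prop :=
  ∃ δ : ℝ, 0 < δ ∧
    (∀ μ : Measure B.PathSpace, B.IsErgodicMeasure hB μ →
      (∀ t ∈ mainVertices vtx μ, ∀ n, 1 ≤ n → δ ≤ μ.real {x | tau n x = vtx n t}) ∧
      (∀ t ∉ mainVertices vtx μ,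
        Tendsto (fun n => μ.real {x | tau n x = vtx n t}) atTop (𝓝 0))) ∧
    ∀ μ ν : Measure B.PathSpace, B.IsErgodicMeasure hB μ → B.IsErgodicMeasure hB ν → μ ≠ ν →
      Disjoint (mainVertices vtx μ) (mainVertices vtx ν)

/-- The set `E_{m,n}` of the finite paths from level `m` to level `n`. -/
def FinPath (B : OrderedBratteliDiagram.{u}) (m n : ℕ) : Type u :=
  {p : (i : Set.Ico m n) → B.E i //
    ∀ (i : ℕ) (h : m ≤ i) (h' : i + 1 < n),
      B.tgt (p ⟨i, h, by omega⟩) = B.src (p ⟨i + 1, by omega, h'⟩)}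

instance (B : OrderedBratteliDiagram.{u}) (m n : ℕ) : Finite (B.FinPath m n) :=
  inferInstanceAs (Finite {_p : (i : Set.Ico m n) → B.E i // _})

/-- The strict order induced on the paths from level `m` to level `n`: the last edges at which
the two paths differ decide. -/
def FinPath.Lt {B : OrderedBratteliDiagram.{u}} {m n : ℕ} (p p' : B.FinPath m n) : Prop :=
  ∃ i : Set.Ico m n, (∀ j : Set.Ico m n, i < j → p.1 j = p'.1 j) ∧ p.1 i < p'.1 i

/-- The part `(x_{m+1}, …, x_n)` of an infinite path between the levels `m` and `n`. -/
def segment {B : OrderedBratteliDiagram.{u}} (m n : ℕ) (x : B.PathSpace) : B.FinPath m n :=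
  ⟨fun i => edge x i, fun i _ _ => x.2 i⟩

/-- The number of paths from level `m` to level `n` that end in the same vertex of level `n` as
`x` and are strictly bigger than the part of `x` between these levels. -/
noncomputable def suffix {B : OrderedBratteliDiagram.{u}} (m n : ℕ) (x : B.PathSpace) : ℕ :=
  Nat.card {p : B.FinPath m n //
    (∀ i : Set.Ico m n, (i : ℕ) + 1 = n → B.tgt (p.1 i) = B.tgt (edge x i)) ∧
      (segment m n x).Lt p}

theorem finite_suffixSet (B : OrderedBratteliDiagram.{u}) (m n : ℕ) (t₁ : B.V m) (t₂ : B.V n) :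
    {s : ℕ | ∃ x : B.PathSpace, tau m x = t₁ ∧ tau n x = t₂ ∧ suffix m n x = s}.Finite := by
  refine (Set.finite_Iic (Nat.card (B.FinPath m n))).subset ?_
  rintro s ⟨x, -, -, rfl⟩
  exact Nat.card_le_card_of_injective Subtype.val Subtype.val_injective

/-- The set of the values of `suffix m n` on the paths through `t₁ ∈ V m` and `t₂ ∈ V n`. -/
noncomputable def suffixSet (B : OrderedBratteliDiagram.{u}) (m n : ℕ) (t₁ : B.V m)
    (t₂ : B.V n) : Finset ℕ :=
  (B.finite_suffixSet m n t₁ t₂).toFinset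

/-- `p_n = q_1 ⋯ q_n` -/
def pProd (q : ℕ → ℕ) (n : ℕ) : ℕ := ∏ i ∈ Finset.Icc 1 n, q i

/-- `q_{m,n} = q_{m+1} ⋯ q_n` -/
def qProd (q : ℕ → ℕ) (m n : ℕ) : ℕ := ∏ i ∈ Finset.Ioc m n, q i

/-- `|∑ s, lam ^ (-p_m s)| / q_{m,n}`, the sum being over the suffix set of `t₁` and `t₂`. -/
noncomputable def suffixRatio (B : OrderedBratteliDiagram.{u}) {d : ℕ}
    (vtx : (n : ℕ) → Fin d → B.V n) (q : ℕ → ℕ) (lam : ℂ) (m n : ℕ) (t₁ t₂ : Fin d) : ℝ :=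
  ‖∑ s ∈ B.suffixSet m n (vtx m t₁) (vtx n t₂), lam ^ (-((pProd q m * s : ℕ) : ℤ))‖ /
    (qProd q m n : ℝ)

/-- For all `t₂ ∈ I`, the sum of the ratios over `t₁ ∈ J` tends to `1` as `m, n → ∞`, uniformly
in `m < n`. -/
def MainCondition (B : OrderedBratteliDiagram.{u}) {d : ℕ}
    (vtx : (n : ℕ) → Fin d → B.V n) (q : ℕ → ℕ) (lam : ℂ) (I J : Finset (Fin d)) : Prop :=
  ∀ t₂ ∈ I, ∀ ε : ℝ, 0 < ε → ∃ N : ℕ, ∀ m n : ℕ, N ≤ m → m < n →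
    |∑ t₁ ∈ J, B.suffixRatio vtx q lam m n t₁ t₂ - 1| < ε

/-- For all `t₂ ∈ I` there are partitions `H m n`, `1 ≤ m < n`, of `J` into exactly `k` atoms such
that the sum of the ratios over `t₁` in an atom `A` of `H m n` tends to `1 / k` as `m, n → ∞`,
uniformly in `m < n` and `A`. -/
def PartitionCondition (B : OrderedBratteliDiagram.{u}) {d : ℕ}
    (vtx : (n : ℕ) → Fin d → B.V n) (q : ℕ → ℕ) (lam : ℂ) (k : ℕ) (I J : Finset (Fin d)) : Prop :=
  ∀ t₂ ∈ I, ∃ H : ℕ → ℕ → Finpartition J,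
    (∀ m n : ℕ, 1 ≤ m → m < n → (H m n).parts.card = k) ∧
    ∀ ε : ℝ, 0 < ε → ∃ N : ℕ, ∀ m n : ℕ, N ≤ m → m < n → ∀ A ∈ (H m n).parts,
      |∑ t₁ ∈ A, B.suffixRatio vtx q lam m n t₁ t₂ - 1 / (k : ℝ)| < ε

end OrderedBratteliDiagram

/-! Order the paths from level `m` to a fixed vertex of level `n`. The suffix of a path is then a
mixed-radix number whose digits are the ranks of its edges (`suffix_succ`), so the suffix sets of
distinct `t₁` are disjoint subsets of `{0, …, Q - 1}`, where `Q = q_{m,n}`. For large `m` the number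
`ζ = lam ^ (-p_m)` is a primitive root of unity of order `k = bb`.

From partitions to the main condition, one adds up the `k` atoms. Conversely, if the norms of the
sums of `ζ ^ s` over the suffix sets add up to almost `Q`, hardly any cancellation occurs inside a
suffix set, so almost all its elements lie in one residue class modulo `k`
(`exists_residue_class_defect`). Group the `t₁` by this class. A class has at most `Q / k + 1`
elements below `Q`, so no group can exceed its share by much; as the total is almost `Q`, each group
gets almost `Q / k` (`abs_sum_fiber_sub_le`).

The rounding error is of order `k / Q`, so `Q` must be large uniformly in `n > m`, that is,
`q_{m+1}` must be large. For `k ≠ 1` the main condition forces this (`MainCondition.exists_lt`): all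
maximal edges leaving level `m` have the same source, whose suffix set therefore contains all
multiples of `q_{m+1}` below `Q`. Along these the sum is geometric with ratio different from `1`,
hence bounded, and about `Q / q_{m+1}` is lost from the total. For `k = 1` the partition with the
single atom `J` serves.

Nothing here depends on which `J` is taken. -/

namespace OrderedBratteliDiagram

variable {B : OrderedBratteliDiagram.{u}}

/-! ### Ranks of edges -/

/-- The number of edges that are bigger than `e`. -/
noncomputable def rank {n : ℕ} (e : B.E n) : ℕ := Nat.card {f : B.E n // e < f}

theorem tgt_eq_of_le {n : ℕ} {e f : B.E n} (h : e ≤ f) : B.tgt e = B.tgt f :=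
  (B.comparable_iff n e f).1 (Or.inl h)

theorem rank_lt {q : ℕ → ℕ} (hq : B.IsToeplitz q) {n : ℕ} (e : B.E n) : rank e < q (n + 1) := by
  rw [← hq n (B.tgt e)]
  exact Set.ncard_lt_ncard (s := {f | e < f}) (t := {f | B.tgt f = B.tgt e})
    ((Set.ssubset_iff_of_subset fun f hf => (tgt_eq_of_le (le_of_lt hf)).symm).2
      ⟨e, rfl, lt_irrefl e⟩) (Set.toFinite _)

theorem rank_strictAnti {n : ℕ} {e f : B.E n} (h : e < f) : rank f < rank e :=
  Set.ncard_lt_ncard (s := {g | f < g}) (t := {g | e < g})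
    ((Set.ssubset_iff_of_subset fun _ hg => lt_trans h hg).2 ⟨f, h, lt_irrefl f⟩) (Set.toFinite _)

theorem isMax_of_rank_eq_zero {n : ℕ} {e : B.E n} (he : rank e = 0) : IsMax e := by
  refine fun f hf => (hf.eq_or_lt).elim (fun h => h.ge) fun h => ?_
  exact absurd (he ▸ rank_strictAnti h) (Nat.not_lt_zero _)

theorem eq_of_rank_eq {n : ℕ} {e f : B.E n} (ht : B.tgt e = B.tgt f) (h : rank e = rank f) :
    e = f := by
  rcases (B.comparable_iff n e f).2 ht with h' | h'
  · exact h'.eq_or_lt.elim id fun h'' => absurd h (rank_strictAnti h'').ne'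
  · exact h'.eq_or_lt.elim Eq.symm fun h'' => absurd h (rank_strictAnti h'').ne

/-- The rank is injective on the edges into `v`, and there are exactly as many of these as possible
values. -/
theorem exists_rank_eq {q : ℕ → ℕ} (hq : B.IsToeplitz q) {n : ℕ} (v : B.V (n + 1)) {r : ℕ}
    (hr : r < q (n + 1)) : ∃ e : B.E n, B.tgt e = v ∧ rank e = r := by
  let g : {e : B.E n // B.tgt e = v} → Fin (q (n + 1)) := fun e => ⟨rank e.1, rank_lt hq e.1⟩
  have hg : Function.Injective g := fun e f hef =>
    Subtype.ext (eq_of_rank_eq (e.2.trans f.2.symm) (Fin.ext_iff.1 hef))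
  obtain ⟨e, he⟩ := (hg.bijective_of_nat_card_le (by rw [hq n v, Nat.card_fin])).2 ⟨r, hr⟩
  exact ⟨e.1, e.2, Fin.ext_iff.1 he⟩

/-! ### Counting finite paths; suffixes as mixed-radix numbers -/

theorem qProd_self (q : ℕ → ℕ) (m : ℕ) : qProd q m m = 1 := by simp [qProd]

theorem qProd_succ (q : ℕ → ℕ) {m n : ℕ} (h : m ≤ n) :
    qProd q m (n + 1) = qProd q m n * q (n + 1) := by
  rw [qProd, qProd, ← Finset.insert_Ioc_right_eq_Ioc_add_one h, Finset.prod_insert (by simp),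
    mul_comm]

theorem qProd_self_succ (q : ℕ → ℕ) (m : ℕ) : qProd q m (m + 1) = q (m + 1) := by
  rw [qProd_succ q le_rfl, qProd_self, one_mul]

theorem qProd_mul_qProd (q : ℕ → ℕ) {l m n : ℕ} (hlm : l ≤ m) (hmn : m ≤ n) :
    qProd q l m * qProd q m n = qProd q l n :=
  Finset.prod_Ioc_consecutive q hlm hmn

theorem pProd_mul_qProd (q : ℕ → ℕ) {m n : ℕ} (h : m ≤ n) :
    pProd q m * qProd q m n = pProd q n :=
  Finset.prod_Ioc_consecutive q (Nat.zero_le m) h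

/-- The finite path `p` from level `m` to level `n` ends in the vertex `v`, if `m < n`. -/
def FinPath.EndsAt {m n : ℕ} (p : B.FinPath m n) (v : B.V n) : Prop :=
  ∀ i : Set.Ico m n, (i : ℕ) + 1 = n → HEq (B.tgt (p.1 i)) v

/-- Only the end condition depends on the edge, so the paths can be compared by plain equality. -/
theorem sigma_endsAt_ext {m n : ℕ} {y z : Σ e : B.E n, {p : B.FinPath m n // p.EndsAt (B.src e)}}
    (h₁ : y.1 = z.1) (h₂ : y.2.1 = z.2.1) : y = z := by
  obtain ⟨e, p, hp⟩ := y
  obtain ⟨f, r, hr⟩ := z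
  dsimp only at h₁ h₂
  subst h₁ h₂
  rfl

/-- Paths to level `n + 1` are paths to level `n` followed by an edge. -/
noncomputable def finPathSuccEquiv {m n : ℕ} (h : m ≤ n) :
    B.FinPath m (n + 1) ≃ Σ e : B.E n, {p : B.FinPath m n // p.EndsAt (B.src e)} where
  toFun p := ⟨p.1 ⟨n, h, n.lt_succ_self⟩,
    ⟨fun i => p.1 ⟨i, i.2.1, i.2.2.trans n.lt_succ_self⟩,
      fun i h1 h2 => p.2 i h1 (h2.trans n.lt_succ_self)⟩, by
      rintro ⟨i, hi⟩ hin
      obtain rfl : n = i + 1 := hin.symm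
      exact heq_of_eq (p.2 i hi.1 (Nat.lt_succ_self _))⟩
  invFun y := ⟨fun i => if hi : (i : ℕ) < n then y.2.1.1 ⟨i, i.2.1, hi⟩ else
      (Nat.le_antisymm (not_lt.1 hi) (Nat.lt_succ_iff.1 i.2.2)) ▸ y.1, by
    obtain ⟨e, p, hp⟩ := y
    intro i h1 h2
    rcases Nat.lt_or_ge (i + 1) n with h3 | h3
    · simp only [show i < n by omega, h3, dite_true]
      exact p.2 i h1 h3
    · obtain rfl : n = i + 1 := by omega
      simp only [show i < i + 1 by omega, lt_irrefl, dite_true, dite_false]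
      exact eq_of_heq (hp ⟨i, h1, Nat.lt_succ_self i⟩ rfl)⟩
  left_inv p := by
    apply Subtype.ext
    funext ⟨i, hi⟩
    rcases Nat.lt_or_ge i n with h3 | h3
    · simp [h3]
    · obtain rfl : n = i := by have := hi.2; omega
      simp
  right_inv y := by
    obtain ⟨e, p, hp⟩ := y
    refine sigma_endsAt_ext (by simp) ?_
    apply Subtype.ext
    funext ⟨i, hi⟩
    simp [hi.2]

theorem card_endsAt {q : ℕ → ℕ} (hq : B.IsToeplitz q) (m : ℕ) {n : ℕ} (h : m ≤ n) (v : B.V n) :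
    Nat.card {p : B.FinPath m n // p.EndsAt v} = qProd q m n := by
  induction n, h using Nat.le_induction with
  | base =>
    -- For `n = m` there is only the empty path, and `EndsAt` is vacuous.
    rw [qProd_self, Nat.card_eq_one_iff_unique]
    refine ⟨⟨fun p p' => Subtype.ext (Subtype.ext (funext fun i => ?_))⟩,
      ⟨⟨fun i => ?_, fun i h1 h2 => ?_⟩, fun i => ?_⟩⟩
    all_goals first | exact absurd (i.2.1.trans_lt i.2.2) (lt_irrefl m) | omega
  | succ n hn ih =>
    have e1 : {p : B.FinPath m (n + 1) // p.EndsAt v} ≃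
        {y : Σ e : B.E n, {p : B.FinPath m n // p.EndsAt (B.src e)} // B.tgt y.1 = v} :=
      (finPathSuccEquiv hn).subtypeEquiv fun p => by
        constructor
        · exact fun hp => eq_of_heq (hp ⟨n, hn, n.lt_succ_self⟩ rfl)
        · rintro hp ⟨i, hi⟩ hin
          obtain rfl : i = n := by simpa using hin
          exact heq_of_eq hp
    have e2 := e1.trans (Equiv.subtypeSigmaEquiv
      (fun e : B.E n => {p : B.FinPath m n // p.EndsAt (B.src e)}) fun e => B.tgt e = v)
    have := Fintype.ofFinite {e : B.E n // B.tgt e = v}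
    rw [Nat.card_congr e2, Nat.card_sigma, Finset.sum_congr rfl fun e _ => ih (B.src e.1),
      Finset.sum_const, Finset.card_univ, ← Nat.card_eq_fintype_card, hq n v, qProd_succ q hn,
      smul_eq_mul, mul_comm]

/-- Puts the end condition into the form that `card_endsAt` counts. -/
theorem suffix_eq_card {m n : ℕ} (x : B.PathSpace) :
    suffix m n x =
      Nat.card {p : {p : B.FinPath m n // p.EndsAt (tau n x)} // (segment m n x).Lt p.1} := by
  refine (Nat.card_congr (Equiv.subtypeSubtypeEquivSubtypeInter _ _)).symm ▸
    Nat.card_congr (Equiv.subtypeEquivRight fun p => and_congr_left fun _ => ?_)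
  refine forall_congr' fun ⟨i, hi⟩ => forall_congr' fun hin => ?_
  obtain rfl : n = i + 1 := hin.symm
  rw [heq_iff_eq, tau, ← show B.tgt (edge x i) = B.src (edge x (i + 1)) from x.2 i]

theorem suffix_self (m : ℕ) (x : B.PathSpace) : suffix m m x = 0 := by
  have : IsEmpty {p : B.FinPath m m //
    (∀ i : Set.Ico m m, (i : ℕ) + 1 = m → B.tgt (p.1 i) = B.tgt (edge x i)) ∧
      (segment m m x).Lt p} := ⟨fun ⟨_, _, i, _⟩ => absurd (i.2.1.trans_lt i.2.2) (lt_irrefl m)⟩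
  exact Nat.card_of_isEmpty

/-- A bigger path either shares the last edge and is bigger before it (`low`), or has a bigger last
edge and is free below (`high`). Thus the rank of the last edge is the leading digit. -/
theorem suffix_succ {q : ℕ → ℕ} (hq : B.IsToeplitz q) {m n : ℕ} (h : m ≤ n) (x : B.PathSpace) :
    suffix m (n + 1) x = suffix m n x + qProd q m n * rank (edge x n) := by
  classical
  let P : B.E n → Type u := fun e => {p : B.FinPath m n // p.EndsAt (B.src e)}
  let low : (Σ e, P e) → Prop := fun y => edge x n = y.1 ∧ (segment m n x).Lt y.2.1
  let high : (Σ e, P e) → Prop := fun y => edge x n < y.1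
  have e1 : {p : B.FinPath m (n + 1) //
      (∀ i : Set.Ico m (n + 1), (i : ℕ) + 1 = n + 1 → B.tgt (p.1 i) = B.tgt (edge x i)) ∧
      (segment m (n + 1) x).Lt p} ≃ {y : Σ e, P e // low y ∨ high y} :=
    (finPathSuccEquiv h).subtypeEquiv fun p => by
      constructor
      · rintro ⟨-, ⟨i, hi⟩, hlt, hi'⟩
        rcases Nat.lt_or_ge i n with h3 | h3
        · exact Or.inl ⟨hlt ⟨n, h, n.lt_succ_self⟩ h3, ⟨i, hi.1, h3⟩,
            fun j hj => hlt ⟨j, j.2.1, j.2.2.trans n.lt_succ_self⟩ hj, hi'⟩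
        · obtain rfl : i = n := by have := hi.2; omega
          exact Or.inr hi'
      · intro hp
        refine ⟨?_, ?_⟩
        · rintro ⟨i, hi⟩ hin
          obtain rfl : i = n := by simpa using hin
          rcases hp with hp | hp
          · exact congrArg B.tgt hp.1.symm
          · exact (tgt_eq_of_le (le_of_lt hp)).symm
        · rcases hp with ⟨h1, i, h2, h3⟩ | hp
          · refine ⟨⟨i, i.2.1, i.2.2.trans n.lt_succ_self⟩, ?_, h3⟩
            rintro ⟨j, hj⟩ hij
            rcases Nat.lt_or_ge j n with h4 | h4
            · exact h2 ⟨j, hj.1, h4⟩ hij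
            · obtain rfl : j = n := by have := hj.2; omega
              exact h1
          · refine ⟨⟨n, h, n.lt_succ_self⟩, ?_, hp⟩
            rintro ⟨j, hj⟩ hij
            exact absurd hj.2 (not_lt.2 hij)
  have hdisj : Disjoint {y | low y} {y | high y} :=
    Set.disjoint_left.2 fun y h1 h2 => h2.ne h1.1
  have e2 : {y : Σ e, P e // low y} ≃ {p : P (edge x n) // (segment m n x).Lt p.1} :=
    { toFun := fun y => ⟨⟨y.1.2.1, by
        rw [y.2.1]; exact y.1.2.2⟩, y.2.2⟩
      invFun := fun p => ⟨⟨edge x n, p.1⟩, rfl, p.2⟩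
      left_inv := by
        rintro ⟨⟨e, p⟩, h1, h2⟩
        dsimp only at h1
        subst h1
        rfl
      right_inv := fun p => rfl }
  have e3 : {y : Σ e, P e // high y} ≃ Σ e : {e : B.E n // edge x n < e}, P e.1 :=
    Equiv.subtypeSigmaEquiv P fun e => edge x n < e
  have hfin : ∀ e, Finite (P e) := fun e => inferInstanceAs (Finite {_p : B.FinPath m n // _})
  have := Fintype.ofFinite {e : B.E n // edge x n < e}
  have hor : Nat.card {y // low y ∨ high y} = Nat.card {y // low y} + Nat.card {y // high y} :=
    Set.ncard_union_eq hdisj (Set.toFinite _) (Set.toFinite _)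
  rw [suffix_eq_card (n := n), suffix, Nat.card_congr e1, hor, Nat.card_congr e2, Nat.card_congr e3, Nat.card_sigma,
    Finset.sum_congr rfl fun e _ => card_endsAt hq m h (B.src e.1), Finset.sum_const,
    Finset.card_univ, ← Nat.card_eq_fintype_card, smul_eq_mul, mul_comm]
  rfl

theorem suffix_lt {q : ℕ → ℕ} (hq : B.IsToeplitz q) {m n : ℕ} (h : m ≤ n) (x : B.PathSpace) :
    suffix m n x < qProd q m n := by
  induction n, h using Nat.le_induction with
  | base => simp [suffix_self, qProd_self]
  | succ n hn ih =>
    rw [suffix_succ hq hn, qProd_succ q hn]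
    have := rank_lt hq (edge x n)
    nlinarith

/-- Mixed-radix digits are unique: the end vertex and the leading digit give the last edge, and its
source is the next end vertex to descend from. -/
theorem tau_eq_of_suffix_eq {q : ℕ → ℕ} (hq : B.IsToeplitz q) {m n : ℕ} (h : m ≤ n)
    {x y : B.PathSpace} (ht : tau n x = tau n y) (hs : suffix m n x = suffix m n y) :
    tau m x = tau m y := by
  induction n, h using Nat.le_induction with
  | base => exact ht
  | succ n hn ih =>
    rw [suffix_succ hq hn, suffix_succ hq hn] at hs
    have hx := suffix_lt hq hn x
    have hy := suffix_lt hq hn y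
    have hmod := congrArg (· % qProd q m n) hs
    have hdiv := congrArg (· / qProd q m n) hs
    simp only [Nat.add_mul_mod_self_left, Nat.mod_eq_of_lt hx, Nat.mod_eq_of_lt hy,
      Nat.add_mul_div_left _ _ (Nat.zero_lt_of_lt hx), Nat.div_eq_of_lt hx, Nat.div_eq_of_lt hy,
      zero_add] at hmod hdiv
    have hedge : edge x n = edge y n := by
      refine eq_of_rank_eq ?_ hdiv
      exact (x.2 n).trans (ht.trans (y.2 n).symm)
    exact ih (congrArg B.src hedge) hmod

/-- The same expansion, split at its lowest digit, so that the suffix modulo `q (m + 1)` reveals the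
first edge. -/
theorem suffix_eq_rank_add {q : ℕ → ℕ} (hq : B.IsToeplitz q) {m n : ℕ} (h : m + 1 ≤ n)
    (x : B.PathSpace) :
    suffix m n x = rank (edge x m) + q (m + 1) * suffix (m + 1) n x := by
  induction n, h using Nat.le_induction with
  | base => rw [suffix_succ hq le_rfl, suffix_self, suffix_self, qProd_self]; simp
  | succ n hn ih =>
    rw [suffix_succ hq (by omega), suffix_succ hq hn, ih,
      ← qProd_mul_qProd q m.le_succ hn, Nat.succ_eq_add_one, qProd_self_succ]
    ring

/-! ### Infinite paths with prescribed edges and suffixes -/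

/-- Only the tail from `n` on is a path; the edges below `n` are filler, discarded in
`exists_path_extending`. -/
theorem exists_infinite_path (B : OrderedBratteliDiagram.{u}) (n : ℕ) (v : B.V n) :
    ∃ p : (i : ℕ) → B.E i, B.src (p n) = v ∧ ∀ i, n ≤ i → B.tgt (p i) = B.src (p (i + 1)) := by
  choose g hg using fun i => B.src_surjective i
  have hE : ∀ i, Nonempty (B.V i) := by
    intro i
    induction i with
    | zero => exact ⟨B.root⟩
    | succ k ih => exact ih.elim fun w => ⟨B.tgt (g k w)⟩
  let w : (i : ℕ) → B.V i := fun i =>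
    if h : n ≤ i then Nat.leRecOn h (fun {k} w => B.tgt (g k w)) v else (hE i).some
  refine ⟨fun i => g i (w i), ?_, fun i hi => ?_⟩
  · simp [hg, w, Nat.leRecOn_self]
  · rw [hg]
    simp only [w, hi, Nat.le_succ_of_le hi, dite_true]
    rw [Nat.leRecOn_succ hi]

/-- A path can be changed from level `n` on. -/
theorem exists_path_extending (x : B.PathSpace) {n : ℕ} {e : B.E n} (h : tau n x = B.src e) :
    ∃ y : B.PathSpace, (∀ i < n, edge y i = edge x i) ∧ edge y n = e := by
  obtain ⟨p, hp1, hp2⟩ := B.exists_infinite_path (n + 1) (B.tgt e)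
  let y : (i : ℕ) → B.E i := fun i => if i ≤ n then Function.update x.1 n e i else p i
  have hlow : ∀ i < n, y i = x.1 i := by
    intro i hi
    simp only [y]
    rw [if_pos hi.le, Function.update_of_ne hi.ne]
  have hmid : y n = e := by simp [y]
  have hhigh : ∀ i, n < i → y i = p i := fun i hi => if_neg (by omega)
  refine ⟨⟨y, fun i => ?_⟩, hlow, hmid⟩
  rcases Nat.lt_trichotomy (i + 1) n with h1 | h1 | h1
  · rw [hlow i (by omega), hlow (i + 1) h1]
    exact x.2 i
  · subst h1
    rw [hlow i (by omega), hmid]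
    exact (x.2 i).trans h
  · rcases Nat.lt_or_ge n i with h2 | h2
    · rw [hhigh i h2, hhigh (i + 1) h1]
      exact hp2 i h2
    · obtain rfl : i = n := by omega
      rw [hmid, hhigh (i + 1) h1, hp1]

theorem suffix_congr {m n : ℕ} {x y : B.PathSpace} (h : ∀ i < n, edge x i = edge y i) :
    suffix m n x = suffix m n y := by
  have hseg : segment m n x = segment m n y := Subtype.ext (funext fun i => h i i.2.2)
  rw [suffix, suffix, hseg]
  exact Nat.card_congr (Equiv.subtypeEquivRight fun p => and_congr_left fun _ =>
    forall_congr' fun i => by rw [h i i.2.2])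

theorem exists_tau_eq (n : ℕ) (v : B.V n) : ∃ x : B.PathSpace, tau n x = v := by
  induction n with
  | zero =>
    obtain ⟨p, hp1, hp2⟩ := B.exists_infinite_path 0 v
    exact ⟨⟨p, fun i => hp2 i i.zero_le⟩, hp1⟩
  | succ n ih =>
    obtain ⟨e, rfl⟩ := B.tgt_surjective n v
    obtain ⟨x, hx⟩ := ih (B.src e)
    obtain ⟨y, -, hy⟩ := exists_path_extending x hx
    exact ⟨y, (y.2 n).symm.trans (congrArg B.tgt hy)⟩

theorem one_le_of_isToeplitz {q : ℕ → ℕ} (hq : B.IsToeplitz q) (n : ℕ) : 1 ≤ q (n + 1) :=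
  (exists_tau_eq 0 B.root).elim fun x _ => Nat.zero_lt_of_lt (rank_lt hq (edge x n))

/-- The quotient of `s` by `qProd q m n` is the rank of the last edge, and the remainder is handled
by induction. -/
theorem exists_suffix_eq {q : ℕ → ℕ} (hq : B.IsToeplitz q) {m n : ℕ} (h : m ≤ n) (v : B.V n)
    {s : ℕ} (hs : s < qProd q m n) : ∃ x : B.PathSpace, tau n x = v ∧ suffix m n x = s := by
  induction n, h using Nat.le_induction generalizing s with
  | base =>
    obtain ⟨x, hx⟩ := exists_tau_eq m v
    rw [qProd_self] at hs
    exact ⟨x, hx, by rw [suffix_self]; omega⟩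
  | succ n hn ih =>
    rw [qProd_succ q hn] at hs
    obtain ⟨e, rfl, her⟩ := exists_rank_eq hq v (Nat.div_lt_of_lt_mul hs)
    obtain ⟨x, hx, hxs⟩ := ih (B.src e)
      (Nat.mod_lt s (Nat.pos_of_ne_zero fun h0 => by simp [h0] at hs))
    obtain ⟨y, hy1, hy2⟩ := exists_path_extending x hx
    refine ⟨y, (y.2 n).symm.trans (congrArg B.tgt hy2), ?_⟩
    rw [suffix_succ hq hn, hy2, her, suffix_congr hy1, hxs, Nat.mod_add_div]

/-! ### Structure of the suffix sets, and growth of `q` -/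

theorem mem_suffixSet {m n : ℕ} {t₁ : B.V m} {t₂ : B.V n} {s : ℕ} :
    s ∈ B.suffixSet m n t₁ t₂ ↔ ∃ x : B.PathSpace, tau m x = t₁ ∧ tau n x = t₂ ∧ suffix m n x = s :=
  Set.Finite.mem_toFinset _

theorem suffixSet_subset_range {q : ℕ → ℕ} (hq : B.IsToeplitz q) {m n : ℕ} (h : m ≤ n)
    (t₁ : B.V m) (t₂ : B.V n) : B.suffixSet m n t₁ t₂ ⊆ Finset.range (qProd q m n) := by
  intro s hs
  obtain ⟨x, -, -, rfl⟩ := mem_suffixSet.1 hs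
  exact Finset.mem_range.2 (suffix_lt hq h x)

theorem disjoint_suffixSet {q : ℕ → ℕ} (hq : B.IsToeplitz q) {m n : ℕ} (h : m ≤ n)
    {t₁ t₁' : B.V m} (ht : t₁ ≠ t₁') (t₂ : B.V n) :
    Disjoint (B.suffixSet m n t₁ t₂) (B.suffixSet m n t₁' t₂) := by
  refine Finset.disjoint_left.2 fun s hs hs' => ht ?_
  obtain ⟨x, rfl, hx, rfl⟩ := mem_suffixSet.1 hs
  obtain ⟨y, rfl, hy, hxy⟩ := mem_suffixSet.1 hs'
  exact tau_eq_of_suffix_eq hq h (hx.trans hy.symm) hxy.symm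

/-- The paths that begin with a maximal edge start in the common source of the maximal edges. -/
theorem mul_mem_suffixSet {q : ℕ → ℕ} (hq : B.IsToeplitz q) {m n : ℕ} (h : m + 1 ≤ n)
    {t : B.V m} (ht : ∀ e : B.E m, IsMax e → B.src e = t) (t₂ : B.V n) {s : ℕ}
    (hs : s < qProd q (m + 1) n) : q (m + 1) * s ∈ B.suffixSet m n t t₂ := by
  have hpos := one_le_of_isToeplitz hq m
  obtain ⟨x, hx, hxs⟩ : ∃ x : B.PathSpace, tau n x = t₂ ∧ suffix m n x = q (m + 1) * s := by
    refine exists_suffix_eq hq (Nat.le_of_succ_le h) t₂ ?_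
    rw [← qProd_mul_qProd q m.le_succ h, Nat.succ_eq_add_one, qProd_self_succ]
    exact Nat.mul_lt_mul_of_pos_left hs hpos
  refine mem_suffixSet.2 ⟨x, ht _ (isMax_of_rank_eq_zero ?_), hx, hxs⟩
  -- Modulo `q (m + 1)` only the rank of the first edge survives; it is zero, so that edge is
  -- maximal.
  have hmod := congrArg (· % q (m + 1)) ((suffix_eq_rank_add hq h x).symm.trans hxs)
  simpa [Nat.mod_eq_of_lt (rank_lt hq (edge x m))] using hmod

/-- In the path space of a proper diagram of Toeplitz type with no isolated points, infinitely many
of the numbers `q n` are at least two. -/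
theorem exists_two_le {d : ℕ} {vtx : (n : ℕ) → Fin d → B.V n}
    (hB : B.IsProperRepresentation d vtx) {q : ℕ → ℕ} (hq : B.IsToeplitz q) (N : ℕ) :
    ∃ n, N ≤ n ∧ 2 ≤ q (n + 1) := by
  by_contra! hcon
  -- Otherwise edges from level `N` on are determined by their end-points. Any two vertices of a
  -- level above `N` are joined to a common vertex, so they coincide.
  have hsub : ∀ n, N + 1 ≤ n → Subsingleton (B.E n) := by
    have hinj : ∀ n, N ≤ n → Function.Injective (B.tgt : B.E n → _) := by
      intro n hn e f hef
      have h1 := hq n (B.tgt f)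
      have h2 := hcon n hn
      have : Nat.card {e : B.E n // B.tgt e = B.tgt f} ≤ 1 := by omega
      have := Finite.card_le_one_iff_subsingleton.1 this
      exact congrArg Subtype.val
        (Subsingleton.elim (⟨e, hef⟩ : {e : B.E n // B.tgt e = B.tgt f}) ⟨f, rfl⟩)
    have hV : ∀ n, N + 1 ≤ n → ∀ v w : B.V n, v = w := by
      intro n hn v w
      have hpos := hB.incidence_pos n (by omega)
      obtain ⟨⟨g, -⟩⟩ : Nonempty {e : B.E n // B.src e = v} :=
        (B.src_surjective n v).elim fun e he => ⟨⟨e, he⟩⟩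
      obtain ⟨⟨e, he1, he2⟩⟩ := (Nat.card_pos_iff.1 (hpos v (B.tgt g))).1
      obtain ⟨⟨f, hf1, hf2⟩⟩ := (Nat.card_pos_iff.1 (hpos w (B.tgt g))).1
      rw [← he1, ← hf1, hinj n (by omega) (he2.trans hf2.symm)]
    exact fun n hn => ⟨fun e f => hinj n (by omega) (hV (n + 1) (by omega) _ _)⟩
  obtain ⟨x, -⟩ := hB.properlyOrdered.1
  -- Paths agreeing on the edges up to `N` are then equal, so a cylinder is a single point, which is
  -- isolated.
  have hopen : IsOpen ({x} : Set B.PathSpace) := by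
    let _ : ∀ i, TopologicalSpace (B.E i) := fun _ => ⊥
    have _ : ∀ i, DiscreteTopology (B.E i) := fun _ => ⟨rfl⟩
    refine isOpen_induced_iff.2 ⟨(Set.Iio (N + 1)).pi fun i => {x.1 i},
      isOpen_set_pi (Set.finite_Iio _) fun i _ => isOpen_discrete _, ?_⟩
    ext y
    simp only [Set.mem_preimage, Set.mem_pi, Set.mem_Iio, Set.mem_singleton_iff]
    refine ⟨fun hy => Subtype.ext (funext fun i => ?_), fun hy i _ => by rw [hy]⟩
    rcases Nat.lt_or_ge i (N + 1) with hi | hi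
    · exact hy i hi
    · exact (hsub i hi).elim _ _
  have := hB.perfect
  have hne : (𝓝[≠] x).NeBot := inferInstance
  rw [isOpen_singleton_iff_punctured_nhds] at hopen
  exact hne.ne hopen

end OrderedBratteliDiagram

/-! ### Cancellation in sums of roots of unity -/

section RootsOfUnity

theorem norm_add_lt_two {w z : ℂ} (hw : ‖w‖ = 1) (hz : ‖z‖ = 1) (h : w ≠ z) : ‖w + z‖ < 2 := by
  have h1 := parallelogram_law_with_norm ℝ w z
  have h2 : 0 < ‖w - z‖ := norm_pos_iff.2 (sub_ne_zero.2 h)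
  rw [hw, hz] at h1
  nlinarith [norm_nonneg (w + z), mul_pos h2 h2]

/-- There are finitely many pairs of distinct roots, so the strict inequality for each pair gives a
uniform gap. -/
theorem exists_norm_add_rootsOfUnity_le {k : ℕ} (hk : 0 < k) :
    ∃ κ : ℝ, 0 < κ ∧ ∀ w z : ℂ, w ^ k = 1 → z ^ k = 1 → w ≠ z → ‖w + z‖ ≤ 2 - κ := by
  classical
  let F : Finset (ℂ × ℂ) := (Polynomial.nthRootsFinset k (1 : ℂ)).offDiag
  have hF : ∀ p ∈ F, ∀ᶠ κ : ℝ in 𝓝[>] 0, ‖p.1 + p.2‖ ≤ 2 - κ := by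
    intro p hp
    simp only [F, Finset.mem_offDiag, Polynomial.mem_nthRootsFinset hk] at hp
    have := norm_add_lt_two (Complex.norm_eq_one_of_pow_eq_one hp.1 hk.ne')
      (Complex.norm_eq_one_of_pow_eq_one hp.2.1 hk.ne') hp.2.2
    filter_upwards [Ioo_mem_nhdsGT (sub_pos.2 this)] with κ hκ
    linarith [hκ.2]
  obtain ⟨κ, hκ, hκ0⟩ := (((Filter.eventually_all_finset F).2 hF).and self_mem_nhdsWithin).exists
  refine ⟨κ, hκ0, fun w z hw hz hwz => hκ (w, z) ?_⟩
  simp only [F, Finset.mem_offDiag, Polynomial.mem_nthRootsFinset hk]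
  exact ⟨hw, hz, hwz⟩

/-- A sum of powers of a primitive `k`-th root of unity is almost as big as the number of its terms
only if almost all exponents lie in one residue class modulo `k`. -/
theorem exists_residue_class_defect {k : ℕ} (hk : 0 < k) :
    ∃ κ : ℝ, 0 < κ ∧ ∀ ζ : ℂ, IsPrimitiveRoot ζ k → ∀ S : Finset ℕ, ∃ j < k,
      κ * (S.filter fun s => s % k ≠ j).card ≤ S.card - ‖∑ s ∈ S, ζ ^ s‖ := by
  obtain ⟨κ, hκ, hκ'⟩ := exists_norm_add_rootsOfUnity_le hk
  refine ⟨κ / 2, half_pos hκ, fun ζ hζ S => ?_⟩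
  -- The rotation `c` makes the sum real and nonnegative, so the defect becomes a sum of the
  -- nonnegative terms `f s`.
  obtain ⟨c, hc, hcz⟩ := RCLike.exists_norm_eq_mul_self (∑ s ∈ S, ζ ^ s)
  let f : ℕ → ℝ := fun s => 1 - (c * ζ ^ s).re
  have hnorm : ∀ s, ‖ζ ^ s‖ = 1 := fun s => by rw [norm_pow, hζ.norm'_eq_one hk.ne', one_pow]
  have hf0 : ∀ s, 0 ≤ f s := fun s => by
    have := Complex.re_le_norm (c * ζ ^ s)
    rw [norm_mul, hc, hnorm] at this
    simp only [f]
    linarith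
  have hfmod : ∀ s, f s = f (s % k) := fun s => by
    simp only [f]
    rw [← pow_mod_orderOf ζ s, ← hζ.eq_orderOf]
  have hfsum : ∑ s ∈ S, f s = S.card - ‖∑ s ∈ S, ζ ^ s‖ := by
    have h := congrArg Complex.re hcz
    rw [Finset.mul_sum, Complex.re_sum] at h
    simp only [f, Finset.sum_sub_distrib, ← h]
    simp
  obtain ⟨j, hj, hmin⟩ := Finset.exists_min_image (Finset.range k) f ⟨0, Finset.mem_range.2 hk⟩
  rw [Finset.mem_range] at hj
  refine ⟨j, hj, ?_⟩
  -- The gap gives `f s + f j ≥ κ`, and `f j` is minimal, so `f s` carries at least half.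
  have hbad : ∀ s ∈ S.filter (fun s => s % k ≠ j), κ / 2 ≤ f s := by
    intro s hs
    have hsj := (Finset.mem_filter.1 hs).2
    have hlt := Nat.mod_lt s hk
    have h1 := hmin (s % k) (Finset.mem_range.2 hlt)
    have hroot : ∀ i, (ζ ^ i) ^ k = 1 := fun i => by
      rw [← pow_mul, mul_comm, pow_mul, hζ.pow_eq_one, one_pow]
    have h2 := hκ' _ _ (hroot (s % k)) (hroot j) fun h => hsj (hζ.pow_inj hlt hj h)
    have h3 := Complex.re_le_norm (c * (ζ ^ (s % k) + ζ ^ j))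
    rw [norm_mul, hc, one_mul, mul_add, Complex.add_re] at h3
    rw [hfmod]
    simp only [f] at h1 ⊢
    linarith
  calc κ / 2 * (S.filter fun s => s % k ≠ j).card
      = ∑ s ∈ S.filter (fun s => s % k ≠ j), κ / 2 := by
        rw [Finset.sum_const, nsmul_eq_mul, mul_comm]
    _ ≤ ∑ s ∈ S.filter (fun s => s % k ≠ j), f s := Finset.sum_le_sum hbad
    _ ≤ ∑ s ∈ S, f s :=
        Finset.sum_le_sum_of_subset_of_nonneg (Finset.filter_subset _ _) fun s _ _ => hf0 s
    _ = _ := hfsum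

theorem norm_geom_sum_le {x : ℂ} (hx : ‖x‖ = 1) (h : x ≠ 1) (n : ℕ) :
    ‖∑ i ∈ Finset.range n, x ^ i‖ ≤ 2 / ‖x - 1‖ := by
  rw [geom_sum_eq h, norm_div]
  gcongr
  calc ‖x ^ n - 1‖ ≤ ‖x ^ n‖ + ‖(1 : ℂ)‖ := norm_sub_le _ _
    _ = 2 := by rw [norm_pow, hx, one_pow, norm_one]; norm_num

theorem norm_sum_pow_le_card {x : ℂ} (hx : ‖x‖ = 1) (S : Finset ℕ) : ‖∑ s ∈ S, x ^ s‖ ≤ S.card := by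
  refine (norm_sum_le _ _).trans_eq ?_
  simp [hx]

theorem card_filter_range_mod_le {k : ℕ} (hk : 0 < k) (n : ℕ) {j : ℕ} (hj : j < k) :
    (((Finset.range n).filter fun s => s % k = j).card : ℝ) ≤ n / k + 1 := by
  have h := Nat.count_modEq_card n hk j
  rw [Nat.count_eq_card_filter_range] at h
  simp only [Nat.ModEq, Nat.mod_eq_of_lt hj] at h
  rw [h]
  push_cast
  refine add_le_add Nat.cast_div_le ?_
  split_ifs <;> norm_num

end RootsOfUnity

/-! ### Distributing the mass over residue classes; choosing partitions -/

section Partitions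

variable {ι : Type*}

theorem sum_card_le_of_disjoint {J : Finset ι} {S : ι → Finset ℕ} {T : Finset ℕ}
    (hd : (J : Set ι).PairwiseDisjoint S) (hS : ∀ t ∈ J, S t ⊆ T) : ∑ t ∈ J, (S t).card ≤ T.card := by
  classical
  rw [← Finset.card_biUnion hd]
  exact Finset.card_le_card (Finset.biUnion_subset.2 hS)

/-- If disjoint subsets `S t` of `{0, …, Q - 1}` carry almost full exponential sums and `S t` is
concentrated on the residue class of `c t` modulo `k`, then every class gets almost `Q / k`. -/
theorem abs_sum_fiber_sub_le {k : ℕ} (hk : 0 < k) {κ : ℝ} (hκ : 0 < κ) {J : Finset ι}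
    {S : ι → Finset ℕ} {Q : ℕ} (hd : (J : Set ι).PairwiseDisjoint S)
    (hS : ∀ t ∈ J, S t ⊆ Finset.range Q) {z : ι → ℝ} {c : ι → ℕ} (hc : ∀ t, c t < k)
    (hz : ∀ t, κ * ((S t).filter fun s => s % k ≠ c t).card ≤ (S t).card - z t) {δ : ℝ}
    (hδ : (1 - δ) * Q ≤ ∑ t ∈ J, z t) {j : ℕ} (hj : j < k) :
    |∑ t ∈ J with c t = j, z t - Q / k| ≤ Q * δ + Q * δ / κ + k := by
  let b : ι → ℝ := fun t => ((S t).filter fun s => s % k ≠ c t).card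
  have hb0 : ∀ t, 0 ≤ b t := fun t => Nat.cast_nonneg _
  have hk' : (0 : ℝ) < k := Nat.cast_pos.2 hk
  have hk1 : (1 : ℝ) ≤ k := Nat.one_le_cast.2 hk
  have hcard : ∑ t ∈ J, ((S t).card : ℝ) ≤ Q := by
    exact_mod_cast (sum_card_le_of_disjoint hd hS).trans_eq (Finset.card_range Q)
  -- The total defect is at most `Q * δ`, and every stray exponent costs at least `κ`.
  have hbad : ∑ t ∈ J, b t ≤ Q * δ / κ := by
    rw [le_div_iff₀ hκ, mul_comm, Finset.mul_sum]
    have := Finset.sum_le_sum fun t (_ : t ∈ J) => hz t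
    rw [Finset.sum_sub_distrib] at this
    linarith
  have hbad0 : 0 ≤ ∑ t ∈ J, b t := Finset.sum_nonneg fun t _ => hb0 t
  have hδ0 : 0 ≤ (Q : ℝ) * δ := by
    by_contra! hneg
    linarith [div_neg_of_neg_of_pos hneg hκ]
  -- Discarding stray exponents leaves disjoint sets inside one residue class of `{0, …, Q - 1}`.
  have hup : ∀ i < k, ∑ t ∈ J with c t = i, z t ≤ ∑ t ∈ J with c t = i, b t + (Q / k + 1) := by
    intro i hi
    have h1 : ∑ t ∈ J with c t = i, ((S t).filter fun s => s % k = i).card ≤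
        ((Finset.range Q).filter fun s => s % k = i).card := by
      refine sum_card_le_of_disjoint (fun t ht t' ht' htt => ?_) fun t ht => ?_
      · exact Finset.disjoint_filter_filter (hd (Finset.mem_filter.1 ht).1
          (Finset.mem_filter.1 ht').1 htt)
      · exact Finset.filter_subset_filter _ (hS t (Finset.mem_filter.1 ht).1)
    have h2 : (∑ t ∈ J with c t = i, (((S t).filter fun s => s % k = i).card : ℝ)) ≤ Q / k + 1 :=
      le_trans (by exact_mod_cast h1) (card_filter_range_mod_le hk Q hi)
    refine le_trans ?_ (add_le_add_right h2 _)
    rw [← Finset.sum_add_distrib]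
    refine Finset.sum_le_sum fun t ht => ?_
    have hti := (Finset.mem_filter.1 ht).2
    have h3 := Finset.card_filter_add_card_filter_not (s := S t) fun s => s % k = i
    have h4 : ((S t).card : ℝ) = ((S t).filter fun s => s % k = i).card + b t := by
      simp only [b, hti]
      exact_mod_cast h3.symm
    have h5 := hz t
    have h6 : 0 ≤ κ * b t := mul_nonneg hκ.le (hb0 t)
    simp only [b] at h4 h6 ⊢
    linarith
  have hmaps : (J : Set ι).MapsTo c (Finset.range k) :=
    fun t _ => Finset.mem_coe.2 (Finset.mem_range.2 (hc t))
  have hj' : j ∈ Finset.range k := Finset.mem_range.2 hj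
  have hfz := Finset.sum_fiberwise_of_maps_to hmaps z
  have hfb := Finset.sum_fiberwise_of_maps_to hmaps b
  rw [← Finset.add_sum_erase _ _ hj'] at hfz hfb
  have hrest := Finset.sum_le_sum fun i (hi : i ∈ (Finset.range k).erase j) =>
    hup i (Finset.mem_range.1 (Finset.mem_of_mem_erase hi))
  have hbj : 0 ≤ ∑ t ∈ J with c t = j, b t := Finset.sum_nonneg fun t _ => hb0 t
  have hbrest : 0 ≤ ∑ i ∈ (Finset.range k).erase j, ∑ t ∈ J with c t = i, b t :=
    Finset.sum_nonneg fun i _ => Finset.sum_nonneg fun t _ => hb0 t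
  rw [Finset.sum_add_distrib, Finset.sum_const, Finset.card_erase_of_mem hj', Finset.card_range,
    nsmul_eq_mul, Nat.cast_sub hk, Nat.cast_one] at hrest
  -- For the lower bound on class `j`, the upper bounds of the other `k - 1` classes are subtracted
  -- from the total.
  have hkQ : ((k : ℝ) - 1) * (Q / k + 1) = Q - Q / k + k - 1 := by
    field_simp
    ring
  rw [hkQ] at hrest
  have := hup j hj
  rw [abs_le]
  constructor <;> nlinarith

variable [DecidableEq ι]

/-- The partition of `J` into the fibres of a function that takes all values below `k`. -/
theorem exists_finpartition_fibers {J : Finset ι} {k : ℕ} {c : ι → ℕ} (hc : ∀ t ∈ J, c t < k)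
    (hne : ∀ j < k, (J.filter fun t => c t = j).Nonempty) :
    ∃ P : Finpartition J, P.parts.card = k ∧
      ∀ A ∈ P.parts, ∃ j < k, A = J.filter fun t => c t = j := by
  have hinj : Set.InjOn (fun j => J.filter fun t => c t = j) (Finset.range k) := by
    intro i hi j _ hij
    obtain ⟨t, ht⟩ := hne i (Finset.mem_range.1 hi)
    have ht' : t ∈ J.filter fun t => c t = j := by
      dsimp only at hij
      rwa [hij] at ht
    rw [← (Finset.mem_filter.1 ht).2, (Finset.mem_filter.1 ht').2]
  refine ⟨{ parts := (Finset.range k).image fun j => J.filter fun t => c t = j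
            supIndep := ?_, sup_parts := ?_, bot_notMem := ?_ }, ?_, ?_⟩
  · rw [Finset.supIndep_iff_pairwiseDisjoint]
    intro A hA A' hA' hAA
    obtain ⟨i, -, rfl⟩ := Finset.mem_image.1 (Finset.mem_coe.1 hA)
    obtain ⟨j, -, rfl⟩ := Finset.mem_image.1 (Finset.mem_coe.1 hA')
    refine Finset.disjoint_left.2 fun t ht ht' => hAA ?_
    simp only [id, Finset.mem_filter] at ht ht'
    rw [← ht.2, ← ht'.2]
  · ext t
    simp only [Finset.mem_sup, Finset.mem_image, Finset.mem_range, id]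
    constructor
    · rintro ⟨A, ⟨j, -, rfl⟩, ht⟩
      exact (Finset.mem_filter.1 ht).1
    · exact fun ht => ⟨_, ⟨c t, hc t ht, rfl⟩, Finset.mem_filter.2 ⟨ht, rfl⟩⟩
  · intro h
    obtain ⟨j, hj, hj'⟩ := Finset.mem_image.1 h
    exact (hne j (Finset.mem_range.1 hj)).ne_empty hj'
  · exact (Finset.card_image_of_injOn hinj).trans (Finset.card_range k)
  · intro A hA
    obtain ⟨j, hj, rfl⟩ := Finset.mem_image.1 hA
    exact ⟨j, Finset.mem_range.1 hj, rfl⟩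

/-- Partitions that are good up to `ε` can be chosen independently of `ε`. -/
theorem exists_finpartition_family {J : Finset ι} {k : ℕ} {f : ℕ → ℕ → Finset ι → ℝ}
    (h : ∀ ε : ℝ, 0 < ε → ∃ N, ∀ m n, N ≤ m → m < n →
      ∃ P : Finpartition J, P.parts.card = k ∧ ∀ A ∈ P.parts, |f m n A| < ε) :
    ∃ H : ℕ → ℕ → Finpartition J, (∀ m n, (H m n).parts.card = k) ∧
      ∀ ε : ℝ, 0 < ε → ∃ N, ∀ m n, N ≤ m → m < n → ∀ A ∈ (H m n).parts, |f m n A| < ε := by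
  have hne : Nonempty {P : Finpartition J // P.parts.card = k} := by
    obtain ⟨N, hN⟩ := h 1 one_pos
    obtain ⟨P, hP, -⟩ := hN N (N + 1) le_rfl N.lt_succ_self
    exact ⟨⟨P, hP⟩⟩
  -- A partition of least total error is at least as good as the one supplied for any given `ε`. The
  -- divisor `k + 1` below makes the final inequality strict.
  choose H hH using fun m n => Finite.exists_min
    fun P : {P : Finpartition J // P.parts.card = k} => ∑ A ∈ P.1.parts, |f m n A|
  refine ⟨fun m n => (H m n).1, fun m n => (H m n).2, fun ε hε => ?_⟩
  obtain ⟨N, hN⟩ := h (ε / (k + 1)) (by positivity)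
  refine ⟨N, fun m n hm hmn A hA => ?_⟩
  obtain ⟨P, hP, hPA⟩ := hN m n hm hmn
  calc |f m n A| ≤ ∑ A ∈ (H m n).1.parts, |f m n A| :=
        Finset.single_le_sum (f := fun A => |f m n A|) (fun A _ => abs_nonneg _) hA
    _ ≤ ∑ A ∈ P.parts, |f m n A| := hH m n ⟨P, hP⟩
    _ ≤ ∑ _A ∈ P.parts, ε / (k + 1) := Finset.sum_le_sum fun A hA => (hPA A hA).le
    _ = k * (ε / (k + 1)) := by rw [Finset.sum_const, hP, nsmul_eq_mul]
    _ < ε := by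
        rw [← mul_div_assoc, div_lt_iff₀ (by positivity)]
        linarith

end Partitions

/-! ### Exponential sums over suffix sets and the two conditions -/

namespace OrderedBratteliDiagram

variable {B : OrderedBratteliDiagram.{u}} {d : ℕ} {vtx : (n : ℕ) → Fin d → B.V n} {q : ℕ → ℕ}

theorem qProd_pos (hq : B.IsToeplitz q) {m n : ℕ} (h : m ≤ n) : 0 < qProd q m n :=
  (exists_tau_eq 0 B.root).elim fun x _ => Nat.zero_lt_of_lt (suffix_lt hq h x)

theorem le_qProd (hq : B.IsToeplitz q) {m n : ℕ} (h : m < n) : q (m + 1) ≤ qProd q m n := by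
  rw [← qProd_mul_qProd q m.le_succ h, Nat.succ_eq_add_one, qProd_self_succ]
  exact Nat.le_mul_of_pos_right _ (qProd_pos hq h)

theorem exists_le_qProd (hB : B.IsProperRepresentation d vtx) (hq : B.IsToeplitz q) (m C : ℕ) :
    ∃ n, m < n ∧ C ≤ qProd q m n := by
  induction C with
  | zero => exact ⟨m + 1, m.lt_succ_self, Nat.zero_le _⟩
  | succ C ih =>
    obtain ⟨n, hmn, hn⟩ := ih
    obtain ⟨l, hnl, hl⟩ := exists_two_le hB hq n
    refine ⟨l + 1, by omega, ?_⟩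
    have h1 := qProd_mul_qProd q hmn.le hnl
    have h2 := Nat.le_mul_of_pos_right (qProd q m n) (qProd_pos hq hnl)
    have h3 := qProd_pos hq (hmn.le.trans hnl)
    rw [qProd_succ q (hmn.le.trans hnl)]
    nlinarith

theorem suffixRatio_eq (lam : ℂ) (m n : ℕ) (t₁ t₂ : Fin d) :
    B.suffixRatio vtx q lam m n t₁ t₂ =
      ‖∑ s ∈ B.suffixSet m n (vtx m t₁) (vtx n t₂), ((lam ^ pProd q m)⁻¹) ^ s‖ / qProd q m n := by
  rw [suffixRatio]
  congr 2
  refine Finset.sum_congr rfl fun s _ => ?_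
  rw [zpow_neg, zpow_natCast, pow_mul, inv_pow]

theorem pairwiseDisjoint_suffixSet (hB : B.IsProperRepresentation d vtx) (hq : B.IsToeplitz q)
    {m n : ℕ} (hm : 1 ≤ m) (h : m ≤ n) (t₂ : B.V n) (J : Set (Fin d)) :
    J.PairwiseDisjoint fun t₁ => B.suffixSet m n (vtx m t₁) t₂ :=
  fun _ _ _ _ htt =>
    disjoint_suffixSet hq h (fun h' => htt ((hB.vtx_bijective m hm).1 h')) t₂

theorem sum_card_suffixSet_le (hB : B.IsProperRepresentation d vtx) (hq : B.IsToeplitz q)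
    {m n : ℕ} (hm : 1 ≤ m) (h : m ≤ n) (t₂ : B.V n) (J : Finset (Fin d)) :
    ∑ t₁ ∈ J, ((B.suffixSet m n (vtx m t₁) t₂).card : ℝ) ≤ qProd q m n := by
  have := sum_card_le_of_disjoint (pairwiseDisjoint_suffixSet hB hq hm h t₂ (J : Set (Fin d)))
    fun t₁ _ => suffixSet_subset_range hq h (vtx m t₁) t₂
  rw [Finset.card_range] at this
  exact_mod_cast this

/-- The suffix set of the common source of the maximal edges contains a long arithmetic
progression, along which the exponential sum stays bounded. -/
theorem exists_norm_sum_suffixSet_le (hB : B.IsProperRepresentation d vtx) (hq : B.IsToeplitz q)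
    {m : ℕ} (hm : 1 ≤ m) {ζ : ℂ} (hζ : ‖ζ‖ = 1) (hζq : ζ ^ q (m + 1) ≠ 1) :
    ∃ t : Fin d, ∀ n, m + 1 ≤ n → ∀ t₂ : B.V n,
      ‖∑ s ∈ B.suffixSet m n (vtx m t) t₂, ζ ^ s‖ + qProd q (m + 1) n ≤
        (B.suffixSet m n (vtx m t) t₂).card + 2 / ‖ζ ^ q (m + 1) - 1‖ := by
  obtain ⟨v, hv⟩ := hB.maximal_edges m hm
  obtain ⟨t, rfl⟩ := (hB.vtx_bijective m hm).2 v
  refine ⟨t, fun n hn t₂ => ?_⟩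
  set S := B.suffixSet m n (vtx m t) t₂
  have hpos : 0 < q (m + 1) := one_le_of_isToeplitz hq m
  have hinj : Function.Injective fun s : ℕ => q (m + 1) * s := fun i j hij =>
    Nat.eq_of_mul_eq_mul_left hpos hij
  let R := (Finset.range (qProd q (m + 1) n)).image fun s => q (m + 1) * s
  have hR : R ⊆ S := fun s hs => by
    obtain ⟨i, hi, rfl⟩ := Finset.mem_image.1 hs
    exact mul_mem_suffixSet hq hn hv t₂ (Finset.mem_range.1 hi)
  have hcard : R.card = qProd q (m + 1) n := by
    rw [Finset.card_image_of_injective _ hinj, Finset.card_range]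
  have h1 : ‖∑ s ∈ R, ζ ^ s‖ ≤ 2 / ‖ζ ^ q (m + 1) - 1‖ := by
    rw [Finset.sum_image hinj.injOn]
    simp only [pow_mul]
    exact norm_geom_sum_le (by rw [norm_pow, hζ, one_pow]) hζq _
  have h2 := norm_sum_pow_le_card hζ (S \ R)
  have h3 := norm_add_le (∑ s ∈ S \ R, ζ ^ s) (∑ s ∈ R, ζ ^ s)
  rw [Finset.sum_sdiff hR] at h3
  have h4 : ((S \ R).card : ℝ) + qProd q (m + 1) n = S.card := by
    rw [← hcard]
    exact_mod_cast Finset.card_sdiff_add_card_eq_card hR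
  linarith

/-- The source of the maximal edges loses its progression of length `qProd q m n / q (m + 1)`, up to
a constant. This constant depends on `m` but not on `n`. -/
theorem sum_suffixRatio_le (hB : B.IsProperRepresentation d vtx) (hq : B.IsToeplitz q)
    {lam : ℂ} (hlam : ‖lam‖ = 1) {m : ℕ} (hm : 1 ≤ m)
    (hne : ((lam ^ pProd q m)⁻¹) ^ q (m + 1) ≠ 1) :
    ∃ C : ℝ, ∀ n, m + 1 ≤ n → ∀ (J : Finset (Fin d)) (t₂ : Fin d),
      ∑ t₁ ∈ J, B.suffixRatio vtx q lam m n t₁ t₂ ≤ 1 - 1 / q (m + 1) + C / qProd q m n := by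
  have hζ : ‖(lam ^ pProd q m)⁻¹‖ = 1 := by rw [norm_inv, norm_pow, hlam, one_pow, inv_one]
  obtain ⟨t, ht⟩ := exists_norm_sum_suffixSet_le hB hq hm hζ hne
  set ζ := (lam ^ pProd q m)⁻¹
  refine ⟨2 / ‖ζ ^ q (m + 1) - 1‖, fun n hn J t₂ => ?_⟩
  have hQ : (0 : ℝ) < qProd q m n := Nat.cast_pos.2 (qProd_pos hq (Nat.le_of_succ_le hn))
  have hq0 : (0 : ℝ) < q (m + 1) := Nat.cast_pos.2 (one_le_of_isToeplitz hq m)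
  have hprod : (q (m + 1) : ℝ) * qProd q (m + 1) n = qProd q m n := by
    rw [← qProd_mul_qProd q m.le_succ hn, Nat.succ_eq_add_one, qProd_self_succ, Nat.cast_mul]
  simp only [suffixRatio_eq]
  have h1 := ht n hn (vtx n t₂)
  have h2 := sum_card_suffixSet_le hB hq hm (Nat.le_of_succ_le hn) (vtx n t₂) Finset.univ
  have h3 := Finset.sum_le_sum fun t₁ (_ : t₁ ∈ Finset.univ.erase t) =>
    norm_sum_pow_le_card hζ (B.suffixSet m n (vtx m t₁) (vtx n t₂))
  -- The vertex `t` need not lie in `J`, so the estimate is made over all vertices.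
  have h4 := Finset.sum_le_sum_of_subset_of_nonneg (Finset.subset_univ J) fun t₁ _ _ =>
    norm_nonneg (∑ s ∈ B.suffixSet m n (vtx m t₁) (vtx n t₂), ζ ^ s)
  rw [← Finset.add_sum_erase _ _ (Finset.mem_univ t)] at h2 h4
  rw [← Finset.sum_div, div_le_iff₀ hQ, add_mul, sub_mul, div_mul_cancel₀ _ hQ.ne', one_mul]
  have h5 : 1 / (q (m + 1) : ℝ) * qProd q m n = qProd q (m + 1) n := by
    rw [← hprod]
    field_simp
  linarith

theorem isPrimitiveRoot_inv_pow {lam : ℂ} {b : ℕ} (hb : 0 < b) (hlam : IsPrimitiveRoot lam b)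
    (p : ℕ) : IsPrimitiveRoot (lam ^ p)⁻¹ (b / Nat.gcd b p) := by
  refine IsPrimitiveRoot.inv ?_
  have hfin : IsOfFinOrder lam := isOfFinOrder_iff_pow_eq_one.2 ⟨b, hb, hlam.pow_eq_one⟩
  have h := hfin.orderOf_pow lam p
  rw [← hlam.eq_orderOf] at h
  exact h ▸ IsPrimitiveRoot.orderOf (lam ^ p)

/-- Under the main condition, the numbers `q n` tend to infinity, unless the order of
`lam ^ p_n` is eventually one. -/
theorem MainCondition.exists_lt (hB : B.IsProperRepresentation d vtx) (hq : B.IsToeplitz q)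
    {lam : ℂ} {I J : Finset (Fin d)} (h : B.MainCondition vtx q lam I J) {t₂ : Fin d} (ht₂ : t₂ ∈ I)
    {b k N₀ : ℕ} (hb : 0 < b) (hlam : IsPrimitiveRoot lam b)
    (hk : ∀ n, N₀ ≤ n → b / Nat.gcd b (pProd q n) = k) (hk1 : k ≠ 1) {C : ℝ} (hC : 0 < C) :
    ∃ N, ∀ m, N ≤ m → C < q (m + 1) := by
  obtain ⟨N, hN⟩ := h t₂ ht₂ (1 / (2 * C)) (by positivity)
  refine ⟨max (max N N₀) 1, fun m hm => ?_⟩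
  have hmN : N ≤ m := by omega
  have hmN₀ : N₀ ≤ m := by omega
  have hm1 : 1 ≤ m := by omega
  -- This power is the inverse of `lam ^ p_{m+1}`, which still has order `k ≠ 1`.
  have hne : ((lam ^ pProd q m)⁻¹) ^ q (m + 1) ≠ 1 := by
    have hroot := isPrimitiveRoot_inv_pow hb hlam (pProd q (m + 1))
    rw [hk _ (by omega)] at hroot
    rw [inv_pow, ← pow_mul, ← qProd_self_succ q m, pProd_mul_qProd q m.le_succ]
    exact fun h1 => hk1 (hroot.eq_orderOf.trans (by
      rw [Nat.succ_eq_add_one] at h1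
      rw [h1, orderOf_one]))
  obtain ⟨D, hD⟩ := sum_suffixRatio_le hB hq (hlam.norm'_eq_one hb.ne') hm1 hne
  -- As `D` is fixed before `n`, a single far enough level `n` makes its contribution negligible.
  obtain ⟨n, hmn, hn⟩ := exists_le_qProd hB hq m (⌈2 * C * D⌉₊ + 1)
  have h1 := (abs_lt.1 (hN m n hmN hmn)).1
  have h2 := hD n hmn J t₂
  have hQ : (0 : ℝ) < qProd q m n := Nat.cast_pos.2 (qProd_pos hq hmn.le)
  have hq0 : (0 : ℝ) < q (m + 1) := Nat.cast_pos.2 (one_le_of_isToeplitz hq m)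
  have h3 : D / qProd q m n < 1 / (2 * C) := by
    have h4 := Nat.le_ceil (2 * C * D)
    have h5 : ((⌈2 * C * D⌉₊ + 1 : ℕ) : ℝ) ≤ qProd q m n := Nat.cast_le.2 hn
    push_cast at h5
    rw [div_lt_div_iff₀ hQ (by positivity)]
    linarith
  have h6 : 1 / (q (m + 1) : ℝ) < 1 / C := by
    have : 1 / C = 1 / (2 * C) + 1 / (2 * C) := by
      field_simp
      norm_num
    linarith
  exact (one_div_lt_one_div hq0 hC).1 h6

theorem MainCondition.partitionCondition (hB : B.IsProperRepresentation d vtx)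
    (hq : B.IsToeplitz q) {lam : ℂ} {I J : Finset (Fin d)} (h : B.MainCondition vtx q lam I J)
    {b k N₀ : ℕ} (hb : 0 < b) (hlam : IsPrimitiveRoot lam b)
    (hk : ∀ n, N₀ ≤ n → b / Nat.gcd b (pProd q n) = k) :
    B.PartitionCondition vtx q lam k I J := by
  intro t₂ ht₂
  suffices hsuff : ∀ ε : ℝ, 0 < ε → ∃ N, ∀ m n, N ≤ m → m < n →
      ∃ P : Finpartition J, P.parts.card = k ∧
        ∀ A ∈ P.parts, |∑ t₁ ∈ A, B.suffixRatio vtx q lam m n t₁ t₂ - 1 / (k : ℝ)| < ε by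
    obtain ⟨H, hH1, hH2⟩ := exists_finpartition_family hsuff
    exact ⟨H, fun m n _ _ => hH1 m n, hH2⟩
  have hk0 : 0 < k := by
    rw [← hk N₀ le_rfl]
    exact Nat.div_pos (Nat.gcd_le_left _ hb) (Nat.gcd_pos_of_pos_left _ hb)
  intro ε hε
  rcases eq_or_ne k 1 with rfl | hk1
  -- An empty `J` would give the sum `0`, which is not close to `1`.
  · have hJ : J ≠ ⊥ := by
      rintro rfl
      obtain ⟨N, hN⟩ := h t₂ ht₂ 1 one_pos
      simpa using hN N (N + 1) le_rfl N.lt_succ_self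
    obtain ⟨N, hN⟩ := h t₂ ht₂ ε hε
    refine ⟨N, fun m n hm hmn => ⟨Finpartition.indiscrete hJ, rfl, fun A hA => ?_⟩⟩
    obtain rfl : A = J := Finset.mem_singleton.1 hA
    simpa using hN m n hm hmn
  have hk' : (0 : ℝ) < k := Nat.cast_pos.2 hk0
  obtain ⟨κ, hκ, hdefect⟩ := exists_residue_class_defect hk0
  -- The bound `η ≤ 1 / k` will exclude empty fibres, whose error is exactly `1 / k`.
  obtain ⟨η, hη, hηε, hηk⟩ : ∃ η : ℝ, 0 < η ∧ η ≤ ε ∧ η ≤ 1 / k :=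
    ⟨min ε (1 / k), by positivity, min_le_left _ _, min_le_right _ _⟩
  -- Chosen so that the terms with `δ` cost `η / 2`; the rounding error `k / qProd q m n` stays
  -- below the other half because `q (m + 1) > 2 * k / η`.
  let δ := η / (2 * (1 + 1 / κ))
  have hδ : 0 < δ := by positivity
  have hδη : δ + δ / κ = η / 2 := by
    simp only [δ]
    field_simp
  obtain ⟨N, hN⟩ := h t₂ ht₂ δ hδ
  obtain ⟨N₁, hN₁⟩ := h.exists_lt hB hq ht₂ hb hlam hk hk1 (C := 2 * k / η) (by positivity)
  refine ⟨max (max N N₀) (max N₁ 1), fun m n hm hmn => ?_⟩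
  have hroot := isPrimitiveRoot_inv_pow hb hlam (pProd q m)
  rw [hk m (by omega)] at hroot
  have hm1 : 1 ≤ m := by omega
  set ζ := (lam ^ pProd q m)⁻¹ with hζ
  choose c hck hc using fun t₁ : Fin d => hdefect ζ hroot (B.suffixSet m n (vtx m t₁) (vtx n t₂))
  have hQ : (0 : ℝ) < qProd q m n := Nat.cast_pos.2 (qProd_pos hq hmn.le)
  have hQ' : 2 * k / η < qProd q m n :=
    (hN₁ m (by omega)).trans_le (Nat.cast_le.2 (le_qProd hq hmn))
  have hmain := (abs_lt.1 (hN m n (by omega) hmn)).1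
  simp only [suffixRatio_eq, ← hζ, ← Finset.sum_div] at hmain ⊢
  have hfiber : ∀ j < k, |(∑ t₁ ∈ J with c t₁ = j,
      ‖∑ s ∈ B.suffixSet m n (vtx m t₁) (vtx n t₂), ζ ^ s‖) / qProd q m n - 1 / (k : ℝ)| < η := by
    intro j hj
    have h1 := abs_sum_fiber_sub_le hk0 hκ
      (pairwiseDisjoint_suffixSet hB hq hm1 hmn.le (vtx n t₂) (J : Set (Fin d)))
      (fun t₁ _ => suffixSet_subset_range hq hmn.le _ _) hck hc (δ := δ) (by
        rw [← le_div_iff₀ hQ]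
        linarith) hj
    rw [div_sub' hQ.ne', abs_div, abs_of_pos hQ, div_lt_iff₀ hQ, mul_one_div]
    refine h1.trans_lt ?_
    rw [div_lt_iff₀ hη] at hQ'
    have h2 : (qProd q m n : ℝ) * δ + qProd q m n * δ / κ = qProd q m n * (η / 2) := by
      rw [← hδη]
      ring
    rw [h2]
    linarith
  obtain ⟨P, hP, hPA⟩ := exists_finpartition_fibers (J := J) (k := k) (c := c) (fun t _ => hck t) (by
    intro j hj
    by_contra hempty
    have h1 := hfiber j hj
    rw [Finset.not_nonempty_iff_eq_empty.1 hempty, Finset.sum_empty, zero_div, zero_sub, abs_neg,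
      abs_of_pos (by positivity)] at h1
    exact absurd h1 (not_lt.2 hηk))
  refine ⟨P, hP, fun A hA => ?_⟩
  obtain ⟨j, hj, rfl⟩ := hPA A hA
  exact (hfiber j hj).trans_le hηε

theorem PartitionCondition.mainCondition {lam : ℂ} {k : ℕ} (hk : 0 < k) {I J : Finset (Fin d)}
    (h : B.PartitionCondition vtx q lam k I J) : B.MainCondition vtx q lam I J := by
  intro t₂ ht₂ ε hε
  obtain ⟨H, hcard, hH⟩ := h t₂ ht₂
  have hk' : (0 : ℝ) < k := Nat.cast_pos.2 hk
  obtain ⟨N, hN⟩ := hH (ε / k) (by positivity)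
  -- The number of atoms is prescribed only for `m ≥ 1`.
  refine ⟨max N 1, fun m n hm hmn => ?_⟩
  have hc := hcard m n (by omega) hmn
  have hsum : ∑ A ∈ (H m n).parts, (∑ t₁ ∈ A, B.suffixRatio vtx q lam m n t₁ t₂ - 1 / (k : ℝ)) =
      ∑ t₁ ∈ J, B.suffixRatio vtx q lam m n t₁ t₂ - 1 := by
    have h1 := Finset.sum_biUnion (f := fun t₁ => B.suffixRatio vtx q lam m n t₁ t₂)
      (H m n).disjoint
    rw [(H m n).biUnion_parts] at h1
    rw [Finset.sum_sub_distrib, Finset.sum_const, hc, nsmul_eq_mul, mul_one_div_cancel hk'.ne', h1]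
    rfl
  rw [← hsum]
  calc _ ≤ ∑ A ∈ (H m n).parts, |∑ t₁ ∈ A, B.suffixRatio vtx q lam m n t₁ t₂ - 1 / (k : ℝ)| :=
        Finset.abs_sum_le_sum_abs _ _
    _ < ∑ _A ∈ (H m n).parts, ε / k := by
        refine Finset.sum_lt_sum_of_nonempty (Finset.card_pos.1 (hc ▸ hk)) fun A hA => ?_
        exact hN m n (by omega) hmn A hA
    _ = ε := by
        rw [Finset.sum_const, hc, nsmul_eq_mul]
        field_simp

end OrderedBratteliDiagram

theorem mainTheorem4 (B : OrderedBratteliDiagram.{u}) (d : ℕ)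
    (vtx : (n : ℕ) → Fin d → B.V n) (hB : B.IsProperRepresentation d vtx)
    (hclean : B.IsClean hB.properlyOrdered vtx)
    (q : ℕ → ℕ) (hq : B.IsToeplitz q)
    (μ : MeasureTheory.Measure B.PathSpace) (hμ : B.IsErgodicMeasure hB.properlyOrdered μ)
    (a : ℤ) (b : ℕ) (hb : 0 < b) (hab : IsCoprime a (b : ℤ))
    (lam : ℂ) (hlam : lam = Complex.exp (2 * Real.pi * Complex.I * ((a : ℂ) / (b : ℂ))))
    (bb : ℕ)
    (hbb : ∀ᶠ n in Filter.atTop, b / Nat.gcd b (OrderedBratteliDiagram.pProd q n) = bb) :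
    (B.MainCondition vtx q lam (OrderedBratteliDiagram.mainVertices vtx μ) Finset.univ ↔
      B.PartitionCondition vtx q lam bb (OrderedBratteliDiagram.mainVertices vtx μ)
        Finset.univ) ∧
    (B.MainCondition vtx q lam (OrderedBratteliDiagram.mainVertices vtx μ)
        (OrderedBratteliDiagram.mainVertices vtx μ) ↔
      B.PartitionCondition vtx q lam bb (OrderedBratteliDiagram.mainVertices vtx μ)
        (OrderedBratteliDiagram.mainVertices vtx μ)) := by
  have hroot : IsPrimitiveRoot lam b := by
    rw [hlam]
    exact Complex.isPrimitiveRoot_exp_of_isCoprime a b hb.ne' hab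
  obtain ⟨N₀, hN₀⟩ := Filter.eventually_atTop.1 hbb
  have hbb0 : 0 < bb := by
    rw [← hN₀ N₀ le_rfl]
    exact Nat.div_pos (Nat.gcd_le_left _ hb) (Nat.gcd_pos_of_pos_left _ hb)
  exact ⟨⟨fun h => h.partitionCondition hB hq hb hroot hN₀, fun h => h.mainCondition hbb0⟩,
    ⟨fun h => h.partitionCondition hB hq hb hroot hN₀, fun h => h.mainCondition hbb0⟩⟩
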